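/- Let $K$ be a field of characteristic exponent $p$ (so $p=1$ if $\operatorname{char} K=0$ and $p=\operatorname{char}K$ otherwise), and let $\Gamma$ be a group of (field) automorphisms of $K$. For subfields $F,F'$ of $K$ let $FF'$ denote the subfield of $K$ generated by $F\cup F'$; call $F$ and $F'$ \emph{commensurable} if both degrees $[FF':F]$ and $[FF':F']$ are finite. Let $\mathfrak F$ be a family of subfields of $K$ which is $\Gamma$-invariant, that is, $\gamma(F)\in\mathfrak F$ for all $F\in\mathfrak F$ and $\gamma\in\Gamma$, and which is uniformly commensurable, that is, there is $n\in\mathbb N$ with $[FF':F']\le n$ for all $F,F'\in\mathfrak F$. Suppose that at least one of the following holds: (a) for all $F,F'\in\mathfrak F$ the extension $FF'/F$ is separable; (b) for every $F\in\mathfrak F$ the Eršov invariant $[F:F^p]$ is finite, where $F^p=\{x^p : x\in F\}$. Then there is a subfield $N$ of $K$ such that $\gamma(N)=N$ for every $\gamma\in\Gamma$, and $N$ is commensurable with every $F\in\mathfrak F$. -/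

import Mathlib

open scoped Cardinal

namespace Subfield

variable {K : Type*} [Field K]

/-- `F` is commensurably contained in `E` if the degree `[FE : E]` is finite, where the
compositum `FE` (the join of subfields) is taken inside the ambient field `K`. -/
def CommensurablyContained (F E : Subfield K) : Prop :=
  Subfield.relrank E (F ⊔ E) < ℵ₀

/-- `F` and `E` are commensurable if each is commensurably contained in the other. -/
def AreCommensurable (F E : Subfield K) : Prop :=
  CommensurablyContained F E ∧ CommensurablyContained E F

/-- A family of subfields is uniformly commensurable if there is a finite bound on the degrees
`[FE : E]` for `F` and `E` in the family. -/
def UniformlyCommensurable (𝔉 : Set (Subfield K)) : Prop :=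
  ∃ n : ℕ, ∀ F ∈ 𝔉, ∀ E ∈ 𝔉, Subfield.relrank E (F ⊔ E) ≤ n

/-- A family of subfields is invariant under a group `Γ` of automorphisms of `K` if
it contains `γ(F)` for all `F` in the family and all `γ ∈ Γ`. -/
def IsInvariantFamily (Γ : Subgroup (K ≃+* K)) (𝔉 : Set (Subfield K)) : Prop :=
  ∀ γ ∈ Γ, ∀ F ∈ 𝔉, F.map (γ : K →+* K) ∈ 𝔉

/-- A subfield `N` is invariant under `Γ` if `γ(N) = N` for all `γ ∈ Γ`. -/
def IsInvariantUnder (Γ : Subgroup (K ≃+* K)) (N : Subfield K) : Prop :=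
  ∀ γ ∈ Γ, N.map (γ : K →+* K) = N

/-- The extension `FE / F` is separable. -/
def IsSeparableCompositum (F E : Subfield K) : Prop :=
  Algebra.IsSeparable F (Subfield.extendScalars (le_sup_left : F ≤ F ⊔ E))

/-- The Eršov invariant `[F : F ^ p]` as a cardinal, where `p` is the characteristic exponent and
`F ^ p` is the subfield of `p`-th powers of elements of `F`, i.e. the image of `F` under
`x ↦ x ^ p`. (In characteristic zero `p = 1`, and the invariant is `1`.) -/
noncomputable def ersovInvariant (p : ℕ) [ExpChar K p] (F : Subfield K) : Cardinal :=
  Subfield.relrank (F.map (frobenius K p)) F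

end Subfield

/-!
The theorem is reduced to Schlichting's theorem on uniformly commensurable families of subgroups
through the automorphism group of `Ω`, an algebraic closure of `K`.

Write `Fix F` for the group of automorphisms of `Ω` that fix `F` pointwise. An element of `Fix F` is
determined modulo `Fix (F F')` by the embedding of `F F'` over `F` it induces, whence
`[Fix F : Fix F ∩ Fix F'] ≤ [F F' : F]` (`Subfield.relIndex_autFixing`), and the groups `Fix F` for
`F ∈ 𝔉` are uniformly commensurable. Schlichting's theorem
(`Subgroup.exists_conj_invariant_of_uniformly_commensurable`) provides a group `N` commensurable
with all of them and normalized by all lifts of elements of `Γ`; it contains `Fix E` for a finite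
compositum `E` of members of `𝔉` and is contained in the group generated by the `Fix F`.

The latter inclusion implies that `N` preserves the commensurability class of the members of `𝔉`. As
`E` has finitely many translates under `N`, their compositum `E'` is in that class and `N` acts on
it through a finite quotient. By Artin's theorem (`Subfield.finite_separable_fixedPoints`) the
extension `E' / M`, where `M` is the field of invariants of `N` in `E'`, is finite and separable.
Hence `M` is commensurable with `𝔉`. A translate of `M` by a lift of an element of `Γ` consists of
invariants of `N`, hence of `Fix E`, and is therefore purely inseparable over `E`, and then over `M`
(`Subfield.exists_purelyInseparably_invariant`). Likewise `M` is purely inseparable over `K`.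

In the separable case, commensurability can be replaced by its separable version throughout, so that
`M` contains its translates, lies in `K`, and is the field sought. If the Eršov invariants are
finite, then so is `[M : M ^ q]` for every power `q` of `p`. As the degrees of the translates of `M`
over `M` and over the compositum of `𝔉` are bounded, there is one `q` for which the `q`-th powers of
all translates lie in both fields; they generate an invariant field between `M ^ q` and `M`.
-/

/-! ### Uniformly commensurable families of subgroups -/

namespace Subgroup

open scoped Pointwise

variable {G : Type*} [Group G]

/-- If `[H' : H' ∩ F] = [H : H ∩ F]` is finite and `H' ≤ H`, then `H ⊆ H' F`. -/
theorem exists_inv_mul_mem_of_relIndex_eq {H' H F : Subgroup G} (hle : H' ≤ H)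
    (hne : F.relIndex H ≠ 0) (heq : F.relIndex H' = F.relIndex H) {x : G} (hx : x ∈ H) :
    ∃ y ∈ H', y⁻¹ * x ∈ F := by
  have hfin : Finite (H ⧸ F.subgroupOf H) := by
    have : (F.subgroupOf H).FiniteIndex := ⟨hne⟩
    infer_instance
  have hinj := (quotientSubgroupOfEmbeddingOfLE F hle).injective
  have hfin' : Finite (H' ⧸ F.subgroupOf H') := Finite.of_injective _ hinj
  have hbij := (Nat.bijective_iff_injective_and_card _).2 ⟨hinj, heq⟩
  obtain ⟨q, hq⟩ := hbij.2 (QuotientGroup.mk ⟨x, hx⟩)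
  obtain ⟨y, rfl⟩ := QuotientGroup.mk_surjective q
  refine ⟨y, y.2, ?_⟩
  rw [quotientSubgroupOfEmbeddingOfLE_apply_mk, QuotientGroup.eq] at hq
  simpa [mem_subgroupOf] using hq

theorem conj_smul_sInf (g : G) (s : Set (Subgroup G)) :
    MulAut.conj g • sInf s = sInf ((MulAut.conj g • ·) '' s) := by
  ext x
  simp only [mem_pointwise_smul_iff_inv_smul_mem, mem_sInf, Set.forall_mem_image]

/-- Schlichting's theorem: a uniformly commensurable family of subgroups has a commensurable
subgroup `N` normalized by all elements that preserve the family under conjugation. Moreover `N`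
contains a finite intersection of members and lies in the subgroup they generate.

For finite intersections `H` of members, the largest of the indices `[H : H ∩ F]` decreases with
`H`; let `m` be its minimal value. Once `m` is reached, the product set `H F` for `F` with
`[H : H ∩ F] = m` no longer changes when `H` shrinks (as long as the index stays `m`), whence the
intersections `P H` of these sets `H F` increase as `H` shrinks. Their union contains `1`, is
covered by finitely many left cosets of each member, and is preserved by left translation by every
such `H` and by conjugation by elements preserving the family; `N` is its stabilizer under left
translation. -/
theorem exists_conj_invariant_of_uniformly_commensurable {𝔉 : Set (Subgroup G)}
    (h𝔉 : 𝔉.Nonempty) {n : ℕ}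
    (hfin : ∀ F ∈ 𝔉, ∀ E ∈ 𝔉, E.relIndex F ≠ 0) (hn : ∀ F ∈ 𝔉, ∀ E ∈ 𝔉, E.relIndex F ≤ n)
    {Γ : Subgroup G} (hΓ : ∀ g ∈ Γ, ∀ F ∈ 𝔉, MulAut.conj g • F ∈ 𝔉) :
    ∃ N : Subgroup G, (∀ g ∈ Γ, MulAut.conj g • N = N) ∧ N ≤ sSup 𝔉 ∧
      (∀ F ∈ 𝔉, F.relIndex N ≠ 0) ∧
      ∃ s : Set (Subgroup G), s.Finite ∧ s.Nonempty ∧ s ⊆ 𝔉 ∧ sInf s ≤ N := by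
  classical
  -- `s` encodes the finite intersection `sInf s`.
  let Core (s : Set (Subgroup G)) : Prop := s.Finite ∧ s.Nonempty ∧ s ⊆ 𝔉
  have hne : ∀ s, Core s → ∀ F ∈ 𝔉, F.relIndex (sInf s) ≠ 0 := by
    rintro s ⟨-, ⟨E, hE⟩, hs⟩ F hF h0
    exact hfin E (hs hE) F hF (relIndex_eq_zero_of_le_right (sInf_le hE) h0)
  have hex : ∃ k, ∃ s, Core s ∧ ∀ F ∈ 𝔉, F.relIndex (sInf s) ≤ k := by
    obtain ⟨E, hE⟩ := h𝔉
    refine ⟨n, {E}, ⟨Set.finite_singleton E, Set.singleton_nonempty E, by simpa using hE⟩, ?_⟩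
    simpa using fun F hF ↦ hn E hE F hF
  obtain ⟨m, ⟨s₀, hs₀, hs₀m⟩, hmin⟩ : ∃ m, (∃ s, Core s ∧ ∀ F ∈ 𝔉, F.relIndex (sInf s) ≤ m) ∧
      ∀ k < m, ¬ ∃ s, Core s ∧ ∀ F ∈ 𝔉, F.relIndex (sInf s) ≤ k :=
    ⟨Nat.find hex, Nat.find_spec hex, fun k hk ↦ Nat.find_min hex hk⟩
  let Good (s : Set (Subgroup G)) : Prop := Core s ∧ ∀ F ∈ 𝔉, F.relIndex (sInf s) ≤ m
  have hup : ∀ s t, Good s → Core t → s ⊆ t → Good t := fun s t hs ht hst ↦ ⟨ht, fun F hF ↦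
    (relIndex_le_of_le_right (sInf_le_sInf hst) (hne s hs.1 F hF)).trans (hs.2 F hF)⟩
  have hunion : ∀ s t, Good s → Good t → Good (s ∪ t) := fun s t hs ht ↦
    hup s _ hs ⟨hs.1.1.union ht.1.1, hs.1.2.1.inl, Set.union_subset hs.1.2.2 ht.1.2.2⟩
      Set.subset_union_left
  -- The members at which the maximal index `m` is attained.
  let Att (s : Set (Subgroup G)) : Set (Subgroup G) := {F | F ∈ 𝔉 ∧ F.relIndex (sInf s) = m}
  have hatt : ∀ s, Good s → (Att s).Nonempty := by
    intro s hs
    by_contra hcon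
    rw [Set.not_nonempty_iff_eq_empty, Set.eq_empty_iff_forall_notMem] at hcon
    have hlt : ∀ F ∈ 𝔉, F.relIndex (sInf s) < m := fun F hF ↦
      lt_of_le_of_ne (hs.2 F hF) fun h ↦ hcon F ⟨hF, h⟩
    have hm : 0 < m := (Nat.zero_le _).trans_lt (hlt _ h𝔉.some_mem)
    exact hmin (m - 1) (by omega) ⟨s, hs.1, fun F hF ↦ by have := hlt F hF; omega⟩
  have hattmono : ∀ s t, Good s → s ⊆ t → Att t ⊆ Att s := fun s t hs hst F hF ↦
    ⟨hF.1, (hs.2 F hF.1).antisymm <| hF.2 ▸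
      relIndex_le_of_le_right (sInf_le_sInf hst) (hne s hs.1 F hF.1)⟩
  -- Passing from `s` to a larger `t` does not change the set `(⋂ s) F`.
  have hprod : ∀ s t, Good s → s ⊆ t → ∀ F ∈ Att t, ∀ x,
      (∃ h ∈ sInf s, h⁻¹ * x ∈ F) → ∃ h ∈ sInf t, h⁻¹ * x ∈ F := by
    rintro s t hs hst F hF x ⟨h, hh, hx⟩
    obtain ⟨y, hy, hyh⟩ := exists_inv_mul_mem_of_relIndex_eq (sInf_le_sInf hst)
      (hne s hs.1 F hF.1) (hF.2.trans (hattmono s t hs hst hF).2.symm) hh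
    exact ⟨y, hy, by simpa [mul_assoc] using F.mul_mem hyh hx⟩
  -- The intersection of the product sets `(⋂ s) F` over the attaining members `F`.
  let P (s : Set (Subgroup G)) : Set G := {x | ∀ F ∈ Att s, ∃ h ∈ sInf s, h⁻¹ * x ∈ F}
  have hPmono : ∀ s t, Good s → s ⊆ t → P s ⊆ P t := fun s t hs hst x hx F hF ↦
    hprod s t hs hst F hF x (hx F (hattmono s t hs hst hF))
  -- `P t` is even invariant under the larger group `sInf s`, because `(⋂ t) F = (⋂ s) F`.
  have hPmul : ∀ s t, Good s → s ⊆ t → ∀ g ∈ sInf s, ∀ x ∈ P t, g * x ∈ P t := by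
    intro s t hs hst g hg x hx F hF
    obtain ⟨h, hh, hhx⟩ := hx F hF
    refine hprod s t hs hst F hF _ ⟨g * h, mul_mem hg (sInf_le_sInf hst hh), ?_⟩
    simpa [mul_assoc] using hhx
  let Q : Set G := {x | ∃ s, Good s ∧ x ∈ P s}
  have hQone : (1 : G) ∈ Q := ⟨s₀, ⟨hs₀, hs₀m⟩, fun F _ ↦ ⟨1, one_mem _, by simp⟩⟩
  have hQmul : ∀ s, Good s → ∀ g ∈ sInf s, ∀ x ∈ Q, g * x ∈ Q := by
    rintro s hs g hg x ⟨t, ht, hx⟩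
    exact ⟨s ∪ t, hunion s t hs ht, hPmul s _ hs Set.subset_union_left g hg x
      (hPmono t _ ht Set.subset_union_right hx)⟩
  have hGoodconj : ∀ g ∈ Γ, ∀ s, Good s → Good ((MulAut.conj g • ·) '' s) := by
    rintro g hg s ⟨⟨h1, h2, h3⟩, h4⟩
    refine ⟨⟨h1.image _, h2.image _, ?_⟩, fun F hF ↦ ?_⟩
    · rintro _ ⟨F, hF, rfl⟩
      exact hΓ g hg F (h3 hF)
    · have := h4 _ (hΓ g⁻¹ (inv_mem hg) F hF)
      rw [← relIndex_pointwise_smul (MulAut.conj g)] at this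
      rw [← conj_smul_sInf]
      simpa using this
  have hQconj : ∀ g ∈ Γ, ∀ x ∈ Q, g * x * g⁻¹ ∈ Q := by
    rintro g hg x ⟨s, hs, hx⟩
    refine ⟨_, hGoodconj g hg s hs, fun F hF ↦ ?_⟩
    obtain ⟨h, hh, hhx⟩ := hx (MulAut.conj g⁻¹ • F) ⟨hΓ _ (inv_mem hg) F hF.1, by
      rw [← hF.2, ← conj_smul_sInf, ← relIndex_pointwise_smul (MulAut.conj g)]
      simp⟩
    refine ⟨g * h * g⁻¹, ?_, ?_⟩
    · rw [← conj_smul_sInf]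
      exact smul_mem_pointwise_smul h (MulAut.conj g) _ hh
    · rw [mem_pointwise_smul_iff_inv_smul_mem] at hhx
      simpa [mul_assoc] using hhx
  -- `N` is the stabilizer of `Q` under left translation; it lies in `Q` because `1 ∈ Q`.
  let N : Subgroup G :=
    { carrier := {g | ∀ x, g * x ∈ Q ↔ x ∈ Q}
      one_mem' := by simp
      mul_mem' := fun {a b} ha hb x ↦ by rw [mul_assoc, ha, hb]
      inv_mem' := fun {a} ha x ↦ by rw [← ha, mul_inv_cancel_left] }
  have hNQ : ∀ g ∈ N, g ∈ Q := fun g hg ↦ by simpa using (hg 1).2 hQone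
  have hNconj : ∀ g ∈ Γ, MulAut.conj g • N ≤ N := by
    intro g hg x hx
    rw [mem_pointwise_smul_iff_inv_smul_mem] at hx
    intro y
    have key : ∀ g ∈ Γ, ∀ x, g * x * g⁻¹ ∈ Q ↔ x ∈ Q := fun g hg x ↦
      ⟨fun h ↦ by simpa [mul_assoc] using hQconj g⁻¹ (inv_mem hg) _ h, hQconj g hg x⟩
    have := hx (g⁻¹ * y * g⁻¹⁻¹)
    rw [key _ (inv_mem hg), ← key g hg] at this
    simpa [mul_assoc] using this
  refine ⟨N, fun g hg ↦ (hNconj g hg).antisymm ?_, fun g hg ↦ ?_, fun F₀ hF₀ h0 ↦ ?_, s₀, hs₀.1,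
    hs₀.2.1, hs₀.2.2, fun g hg x ↦ ⟨fun h ↦ ?_, hQmul s₀ ⟨hs₀, hs₀m⟩ g hg x⟩⟩
  · have := smul_mono_right (MulAut.conj g) (hNconj g⁻¹ (inv_mem hg))
    simpa using this
  · obtain ⟨s, hs, hx⟩ := hNQ g hg
    obtain ⟨F, hF⟩ := hatt s hs
    obtain ⟨E, hE⟩ := hs.1.2.1
    obtain ⟨h, hh, hhx⟩ := hx F hF
    rw [← mul_inv_cancel_left h g]
    exact mul_mem (le_sSup (hs.1.2.2 hE) (sInf_le hE hh)) (le_sSup hF.1 hhx)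
  · -- Each `P s` is covered by at most `m * n` left cosets of `F₀`, hence so is their directed
    -- union `Q`, which contains `N`.
    have hcov : ∀ s, Good s → ∀ T : Finset (G ⧸ F₀), (∀ q ∈ T, ∃ x ∈ P s, (x : G ⧸ F₀) = q) →
        T.card ≤ m * n := by
      intro s hs T hT
      obtain ⟨F, hF⟩ := hatt s hs
      have h1 : (F.subgroupOf (sInf s)).FiniteIndex := ⟨hne s hs.1 F hF.1⟩
      have h2 : (F₀.subgroupOf F).FiniteIndex := ⟨hfin F hF.1 F₀ hF₀⟩
      let f : ((sInf s : Subgroup G) ⧸ F.subgroupOf (sInf s)) × (F ⧸ F₀.subgroupOf F) → G ⧸ F₀ :=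
        fun p ↦ ((p.1.out * p.2.out : G) : G ⧸ F₀)
      have hf : (T : Set (G ⧸ F₀)) ⊆ Set.range f := by
        intro q hq
        obtain ⟨x, hx, rfl⟩ := hT q hq
        obtain ⟨h, hh, hhx⟩ := hx F hF
        let a : (sInf s : Subgroup G) ⧸ F.subgroupOf (sInf s) := QuotientGroup.mk ⟨h, hh⟩
        have ha : (a.out : G)⁻¹ * h ∈ F := by
          have := QuotientGroup.eq.1 (a.out_eq')
          simpa [mem_subgroupOf] using this
        have hax : (a.out : G)⁻¹ * x ∈ F := by simpa [mul_assoc] using F.mul_mem ha hhx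
        let b : F ⧸ F₀.subgroupOf F := QuotientGroup.mk ⟨_, hax⟩
        have hb : (b.out : G)⁻¹ * ((a.out : G)⁻¹ * x) ∈ F₀ := by
          have := QuotientGroup.eq.1 (b.out_eq')
          simpa [mem_subgroupOf] using this
        exact ⟨(a, b), QuotientGroup.eq.2 (by simpa [mul_assoc] using hb)⟩
      calc T.card = (T : Set (G ⧸ F₀)).ncard := (Set.ncard_coe_finset T).symm
        _ ≤ (Set.range f).ncard := Set.ncard_le_ncard hf (Set.finite_range f)
        _ ≤ Nat.card (((sInf s : Subgroup G) ⧸ F.subgroupOf (sInf s)) × (F ⧸ F₀.subgroupOf F)) := by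
            rw [← Nat.card_coe_set_eq]
            exact Finite.card_range_le f
        _ = F.relIndex (sInf s) * F₀.relIndex F := Nat.card_prod _ _
        _ ≤ m * n := Nat.mul_le_mul hF.2.le (hn F hF.1 F₀ hF₀)
    have hdir : ∀ T : Finset G, (∀ x ∈ T, x ∈ Q) → ∃ s, Good s ∧ ∀ x ∈ T, x ∈ P s := by
      intro T
      induction T using Finset.induction_on with
      | empty => exact fun _ ↦ ⟨s₀, ⟨hs₀, hs₀m⟩, by simp⟩
      | insert a T _ ih =>
        intro hT
        obtain ⟨s, hs, hsT⟩ := ih fun x hx ↦ hT x (Finset.mem_insert_of_mem hx)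
        obtain ⟨t, ht, hat⟩ := hT a (Finset.mem_insert_self a T)
        refine ⟨s ∪ t, hunion s t hs ht, fun x hx ↦ ?_⟩
        obtain rfl | hx := Finset.mem_insert.1 hx
        · exact hPmono t _ ht Set.subset_union_right hat
        · exact hPmono s _ hs Set.subset_union_left (hsT x hx)
    have hinf : Infinite (N ⧸ F₀.subgroupOf N) := index_eq_zero_iff_infinite.1 h0
    obtain ⟨T, hT⟩ := Infinite.exists_subset_card_eq (N ⧸ F₀.subgroupOf N) (m * n + 1)
    let r : N ⧸ F₀.subgroupOf N → G := fun q ↦ (q.out : G)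
    have hinj : Function.Injective fun q ↦ (r q : G ⧸ F₀) := by
      intro q q' h
      rw [← q.out_eq', ← q'.out_eq']
      exact QuotientGroup.eq.2 (by simpa [mem_subgroupOf] using QuotientGroup.eq.1 h)
    obtain ⟨s, hs, hsT⟩ := hdir (T.image r) fun x hx ↦ by
      obtain ⟨q, -, rfl⟩ := Finset.mem_image.1 hx
      exact hNQ _ q.out.2
    have := hcov s hs (T.image fun q ↦ (r q : G ⧸ F₀)) fun q hq ↦ by
      obtain ⟨q', hq', rfl⟩ := Finset.mem_image.1 hq
      exact ⟨r q', hsT _ (Finset.mem_image_of_mem r hq'), rfl⟩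
    rw [Finset.card_image_of_injective _ hinj] at this
    omega
  · simpa using hQmul s₀ ⟨hs₀, hs₀m⟩ g⁻¹ (inv_mem hg) _ h

end Subgroup

/-! ### Automorphisms of algebraically closed fields and purely inseparable elements -/

section Homogeneity

/-- Two embeddings of an algebraic extension `M` of `E` into an algebraically closed field,
which may be transcendental over `E`, differ by an automorphism. A transcendence basis over `E`
remains one over `M` for either embedding, so both sides are algebraic closures of the same
polynomial ring over `M`. -/
theorem exists_ringEquiv_algebraMap_eq {E M Ω₁ Ω₂ : Type*} [Field E] [Field M] [Field Ω₁] [Field Ω₂]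
    [IsAlgClosed Ω₁] [IsAlgClosed Ω₂] [Algebra E M] [Algebra E Ω₁] [Algebra E Ω₂] [Algebra M Ω₁]
    [Algebra M Ω₂] [IsScalarTower E M Ω₁] [IsScalarTower E M Ω₂] [Algebra.IsAlgebraic E M]
    (e : Ω₁ ≃ₐ[E] Ω₂) :
    ∃ g : Ω₁ ≃+* Ω₂, ∀ x : M, g (algebraMap M Ω₁ x) = algebraMap M Ω₂ x := by
  obtain ⟨ι, v, hv⟩ := exists_isTranscendenceBasis' E Ω₁
  have h₁ : IsTranscendenceBasis M v :=
    (Algebra.IsAlgebraic.isTranscendenceBasis_iff E M).1 hv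
  have h₂ : IsTranscendenceBasis M (e ∘ v) :=
    (Algebra.IsAlgebraic.isTranscendenceBasis_iff E M).1 (e.isTranscendenceBasis hv)
  have := IsAlgClosed.isAlgClosure_of_transcendence_basis v h₁
  have := IsAlgClosed.isAlgClosure_of_transcendence_basis (e ∘ v) h₂
  let f := h₁.1.aevalEquiv.symm.trans h₂.1.aevalEquiv
  refine ⟨IsAlgClosure.equivOfEquiv Ω₁ Ω₂ f.toRingEquiv, fun x ↦ ?_⟩
  rw [IsScalarTower.algebraMap_apply M (Algebra.adjoin M (Set.range v)) Ω₁,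
    IsAlgClosure.equivOfEquiv_algebraMap,
    IsScalarTower.algebraMap_apply M (Algebra.adjoin M (Set.range (e ∘ v))) Ω₂]
  exact congrArg _ (f.commutes x)

theorem exists_algEquiv_eq_of_aeval_minpoly {E Ω : Type*} [Field E] [Field Ω] [Algebra E Ω]
    [IsAlgClosed Ω] {x y : Ω} (hx : IsIntegral E x) (hy : Polynomial.aeval y (minpoly E x) = 0) :
    ∃ g : Ω ≃ₐ[E] Ω, g x = y := by
  have : Fact (Irreducible (minpoly E x)) := ⟨minpoly.irreducible hx⟩
  -- The two embeddings of `E[X] / (minpoly E x)` give two algebra structures on the same field.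
  let i₁ : AdjoinRoot (minpoly E x) →ₐ[E] Ω :=
    AdjoinRoot.liftAlgHom _ (Algebra.ofId E Ω) x (minpoly.aeval E x)
  let i₂ : AdjoinRoot (minpoly E x) →ₐ[E] Ω :=
    AdjoinRoot.liftAlgHom _ (Algebra.ofId E Ω) y hy
  have : FiniteDimensional E (AdjoinRoot (minpoly E x)) :=
    (AdjoinRoot.powerBasis (minpoly.ne_zero hx)).finite
  obtain ⟨g, hg⟩ := @exists_ringEquiv_algebraMap_eq E (AdjoinRoot (minpoly E x)) Ω Ω _ _ _ _ _ _ _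
    _ _ i₁.toRingHom.toAlgebra i₂.toRingHom.toAlgebra
    (@IsScalarTower.of_algebraMap_eq' E _ Ω _ _ _ _ i₁.toRingHom.toAlgebra _
      i₁.comp_algebraMap.symm)
    (@IsScalarTower.of_algebraMap_eq' E _ Ω _ _ _ _ i₂.toRingHom.toAlgebra _
      i₂.comp_algebraMap.symm)
    _ AlgEquiv.refl
  have hg : ∀ z, g (i₁ z) = i₂ z := hg
  refine ⟨AlgEquiv.ofRingEquiv (f := g) fun r ↦ ?_, ?_⟩
  · have := hg (algebraMap E _ r)
    rwa [i₁.commutes, i₂.commutes] at this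
  · have h₁ : i₁ (AdjoinRoot.root _) = x := AdjoinRoot.liftAlgHom_root ..
    have h₂ : i₂ (AdjoinRoot.root _) = y := AdjoinRoot.liftAlgHom_root ..
    have := hg (AdjoinRoot.root _)
    rwa [h₁, h₂] at this

/-- An algebraic element fixed by all automorphisms of an algebraically closed extension is purely
inseparable. -/
theorem exists_pow_mem_range_of_forall_algEquiv {E Ω : Type*} [Field E] [Field Ω] [Algebra E Ω]
    [IsAlgClosed Ω] (p : ℕ) [ExpChar E p] {x : Ω} (hx : IsIntegral E x)
    (hfix : ∀ g : Ω ≃ₐ[E] Ω, g x = x) : ∃ k : ℕ, x ^ p ^ k ∈ (algebraMap E Ω).range := by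
  classical
  rw [← minpoly.natSepDegree_eq_one_iff_pow_mem p, Polynomial.natSepDegree_eq_of_isAlgClosed Ω,
    Finset.card_eq_one]
  refine ⟨x, Finset.ext fun y ↦ ?_⟩
  rw [Multiset.mem_toFinset, Polynomial.mem_aroots, Finset.mem_singleton]
  refine ⟨fun ⟨_, hy⟩ ↦ ?_, fun h ↦ ⟨minpoly.ne_zero hx, h ▸ minpoly.aeval E x⟩⟩
  obtain ⟨g, rfl⟩ := exists_algEquiv_eq_of_aeval_minpoly hx hy
  exact hfix g

/-- The exponent of a purely inseparable element is bounded by its degree. -/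
theorem pow_mem_range_of_natDegree_minpoly_le {E Ω : Type*} [Field E] [Field Ω] [Algebra E Ω]
    (p : ℕ) [ExpChar E p] {x : Ω} {d : ℕ} (hd : (minpoly E x).natDegree ≤ d)
    (hx : ∃ k : ℕ, x ^ p ^ k ∈ (algebraMap E Ω).range) : x ^ p ^ d ∈ (algebraMap E Ω).range := by
  obtain hp | hp := ‹ExpChar E p›
  · simpa using hx
  have : ExpChar E p := ExpChar.prime hp
  obtain ⟨k, y, hy⟩ := (minpoly.natSepDegree_eq_one_iff_eq_X_pow_sub_C p).1
    ((minpoly.natSepDegree_eq_one_iff_pow_mem p).2 hx)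
  have hk : x ^ p ^ k = algebraMap E Ω y := by
    have := minpoly.aeval E x
    rwa [hy, map_sub, map_pow, Polynomial.aeval_X, Polynomial.aeval_C, sub_eq_zero] at this
  rw [hy, Polynomial.natDegree_X_pow_sub_C] at hd
  obtain ⟨j, rfl⟩ := Nat.exists_eq_add_of_le ((Nat.lt_pow_self hp.one_lt).le.trans hd)
  rw [pow_add, pow_mul, hk, ← map_pow]
  exact ⟨_, rfl⟩

end Homogeneity

namespace Subfield

universe u

/-! ### Degrees of composita -/

section Degrees

variable {L : Type u} [Field L] {A A' B C : Subfield L}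

/-- The degree `[AB : A]` of the compositum of `A` and `B` over `A`. -/
noncomputable def supDegree (A B : Subfield L) : Cardinal := relrank A (B ⊔ A)

theorem relrank_ne_zero (A B : Subfield L) : relrank A B ≠ 0 := by
  rw [relrank]
  exact rank_pos.ne'

theorem relrank_le_relrank_right (hAB : A ≤ B) (hBC : B ≤ C) : relrank A B ≤ relrank A C := by
  rw [← relrank_mul_relrank hAB hBC]
  exact le_mul_of_one_le_right' (Cardinal.one_le_iff_ne_zero.2 (relrank_ne_zero B C))

theorem relrank_le_relrank_left (hAB : A ≤ B) (hBC : B ≤ C) : relrank B C ≤ relrank A C := by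
  rw [← relrank_mul_relrank hAB hBC]
  exact le_mul_of_one_le_left' (Cardinal.one_le_iff_ne_zero.2 (relrank_ne_zero A B))

theorem supDegree_eq_one_of_le (h : B ≤ A) : supDegree A B = 1 := by
  rw [supDegree, sup_eq_right.2 h, relrank_self]

theorem supDegree_eq_relrank (h : A ≤ B) : supDegree A B = relrank A B := by
  rw [supDegree, sup_eq_left.2 h]

theorem supDegree_mono_right (h : B ≤ C) : supDegree A B ≤ supDegree A C :=
  relrank_le_relrank_right le_sup_right (sup_le_sup_right h A)

theorem supDegree_anti_left (h : A ≤ A') (hfin : supDegree A B < ℵ₀) :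
    supDegree A' B ≤ supDegree A B := by
  let _ : Algebra A A' := (Subfield.inclusion h).toAlgebra
  have : IsScalarTower A A' L := IsScalarTower.of_algebraMap_eq fun _ ↦ rfl
  let M : IntermediateField A L := extendScalars (le_sup_right : A ≤ B ⊔ A)
  rw [supDegree, relrank_eq_rank_of_le le_sup_right] at hfin
  have : FiniteDimensional A M := Module.rank_lt_aleph0_iff.1 hfin
  have hM : IntermediateField.adjoin A' (M : Set L) =
      extendScalars (le_sup_right : A' ≤ B ⊔ A') := by
    refine le_antisymm (IntermediateField.adjoin_le_iff.2 ?_) ?_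
    · exact fun x hx ↦ (sup_le_sup_left h B : B ⊔ A ≤ B ⊔ A') hx
    · rw [extendScalars_le_iff]
      refine sup_le (fun x hx ↦ ?_) fun x hx ↦ ?_
      · exact IntermediateField.subset_adjoin A' (M : Set L) ((le_sup_left : B ≤ B ⊔ A) hx)
      · exact IntermediateField.algebraMap_mem _ (⟨x, hx⟩ : A')
  rw [supDegree, supDegree, relrank_eq_rank_of_le le_sup_right,
    relrank_eq_rank_of_le le_sup_right, ← hM]
  exact IntermediateField.adjoin_rank_le_of_isAlgebraic_right A' M

theorem supDegree_sup_le (hfin : supDegree A C < ℵ₀) :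
    supDegree A (B ⊔ C) ≤ supDegree A B * supDegree A C := by
  calc supDegree A (B ⊔ C) = supDegree A B * supDegree (B ⊔ A) C := by
        rw [supDegree, supDegree, supDegree, relrank_mul_relrank le_sup_right le_sup_right,
          ← sup_assoc, sup_comm B C]
    _ ≤ _ := mul_le_mul_right (supDegree_anti_left le_sup_right hfin) _

/-- The degree of composita satisfies a multiplicative triangle inequality, so that commensurability
is an equivalence relation. -/
theorem supDegree_triangle (hfin : supDegree B C < ℵ₀) :
    supDegree A C ≤ supDegree A B * supDegree B C := by
  calc supDegree A C ≤ supDegree A (B ⊔ C) := supDegree_mono_right le_sup_right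
    _ = supDegree A B * supDegree (B ⊔ A) C := by
        rw [supDegree, supDegree, supDegree, relrank_mul_relrank le_sup_right le_sup_right,
          ← sup_assoc, sup_comm B C]
    _ ≤ _ := mul_le_mul_right (supDegree_anti_left le_sup_left hfin) _

theorem supDegree_map {L' : Type u} [Field L'] (f : L →+* L') (A B : Subfield L) :
    supDegree (A.map f) (B.map f) = supDegree A B := by
  rw [supDegree, ← map_sup, relrank_map_map, supDegree]

/-! ### Commensurability and separability as relations between subfields -/

theorem AreCommensurable.symm (h : AreCommensurable A B) : AreCommensurable B A := ⟨h.2, h.1⟩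

theorem AreCommensurable.trans (h : AreCommensurable A B) (h' : AreCommensurable B C) :
    AreCommensurable A C :=
  ⟨(supDegree_triangle h.1).trans_lt (Cardinal.mul_lt_aleph0 h'.1 h.1),
    (supDegree_triangle h'.2).trans_lt (Cardinal.mul_lt_aleph0 h.2 h'.2)⟩

theorem AreCommensurable.refl (A : Subfield L) : AreCommensurable A A := by
  have : supDegree A A < ℵ₀ := by
    rw [supDegree_eq_one_of_le le_rfl]
    exact Cardinal.one_lt_aleph0
  exact ⟨this, this⟩

theorem AreCommensurable.sup (h : AreCommensurable A C) (h' : AreCommensurable B C) :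
    AreCommensurable (A ⊔ B) C :=
  ⟨(supDegree_sup_le h'.1).trans_lt (Cardinal.mul_lt_aleph0 h.1 h'.1),
    (supDegree_anti_left le_sup_left h.2).trans_lt h.2⟩

theorem areCommensurable_map_map {L' : Type u} [Field L'] (f : L →+* L') :
    AreCommensurable (A.map f) (B.map f) ↔ AreCommensurable A B := by
  change supDegree _ _ < _ ∧ supDegree _ _ < _ ↔ _
  rw [supDegree_map, supDegree_map]
  rfl

/-- Every element of `B` is separable over `A`. -/
def SeparableOver (A B : Subfield L) : Prop := ∀ x ∈ B, IsSeparable A x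

theorem separableOver_of_le (h : B ≤ A) : SeparableOver A B :=
  fun x hx ↦ isSeparable_algebraMap (⟨x, h hx⟩ : A)

theorem SeparableOver.mono_left (h : SeparableOver A B) (hA : A ≤ A') : SeparableOver A' B := by
  let _ : Algebra A A' := (Subfield.inclusion hA).toAlgebra
  have : IsScalarTower A A' L := IsScalarTower.of_algebraMap_eq fun _ ↦ rfl
  exact fun x hx ↦ (h x hx).tower_top A'

theorem SeparableOver.sup (h : SeparableOver A B) (h' : SeparableOver A C) :
    SeparableOver A (B ⊔ C) :=
  sup_le (c := (separableClosure A L).toSubfield) (fun x hx ↦ mem_separableClosure_iff.2 (h x hx))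
    (fun x hx ↦ mem_separableClosure_iff.2 (h' x hx))

theorem SeparableOver.trans (h : SeparableOver A B) (h' : SeparableOver B C) :
    SeparableOver A C := by
  have hAB : A ≤ A ⊔ B := le_sup_left
  let _ : Algebra A (A ⊔ B : Subfield L) := (Subfield.inclusion hAB).toAlgebra
  have : IsScalarTower A (A ⊔ B : Subfield L) L := IsScalarTower.of_algebraMap_eq fun _ ↦ rfl
  have : Algebra.IsSeparable A (A ⊔ B : Subfield L) := ⟨fun x ↦
    IsSeparable.tower_bot (E := L) (((separableOver_of_le le_rfl).sup h) x x.2)⟩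
  exact fun x hx ↦ IsSeparable.of_algebra_isSeparable_of_isSeparable A
    ((h'.mono_left (le_sup_right : B ≤ A ⊔ B)) x hx)

theorem SeparableOver.map {L' : Type*} [Field L'] (f : L →+* L') (h : SeparableOver A B) :
    SeparableOver (A.map f) (B.map f) := by
  rintro _ ⟨x, hx, rfl⟩
  have hs : (minpoly A x).Separable := h x hx
  let f' : A →+* A.map f := f.restrict A (A.map f) fun y hy ↦ ⟨y, hy, rfl⟩
  refine (hs.map (f := f')).of_dvd (minpoly.dvd _ _ ?_)
  rw [Polynomial.aeval_def, Polynomial.eval₂_map]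
  change Polynomial.eval₂ (f.comp (algebraMap A L)) (f x) _ = 0
  rw [← Polynomial.hom_eval₂, ← Polynomial.aeval_def, minpoly.aeval, map_zero]

theorem IsSeparableCompositum.separableOver (h : IsSeparableCompositum A B) :
    SeparableOver A B := by
  have : Algebra.IsSeparable A (extendScalars (le_sup_left : A ≤ A ⊔ B)) := h
  exact fun x hx ↦ mem_separableClosure_iff.1
    (le_separableClosure A L (extendScalars (le_sup_left : A ≤ A ⊔ B))
      ((le_sup_right : B ≤ A ⊔ B) hx))

end Degrees

/-! ### Subfields and groups of automorphisms -/

section Automorphisms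

open scoped Pointwise

variable {L : Type u} [Field L] {A B : Subfield L}

theorem map_mul_ringEquiv (g h : L ≃+* L) (A : Subfield L) :
    A.map ((g * h : L ≃+* L) : L →+* L) = (A.map (h : L →+* L)).map (g : L →+* L) := by
  rw [map_map]
  rfl

theorem map_one_ringEquiv (A : Subfield L) : A.map ((1 : L ≃+* L) : L →+* L) = A :=
  SetLike.coe_injective (Set.image_id (A : Set L))

theorem map_inv_map (g : L ≃+* L) (A : Subfield L) :
    (A.map (g : L →+* L)).map ((g⁻¹ : L ≃+* L) : L →+* L) = A := by
  rw [← map_mul_ringEquiv, inv_mul_cancel, map_one_ringEquiv]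

theorem map_map_inv (g : L ≃+* L) (A : Subfield L) :
    (A.map ((g⁻¹ : L ≃+* L) : L →+* L)).map (g : L →+* L) = A := by
  rw [← map_mul_ringEquiv, mul_inv_cancel, map_one_ringEquiv]

/-- The group of automorphisms of the ambient field fixing `A` pointwise. -/
def autFixing (A : Subfield L) : Subgroup (L ≃+* L) := fixingSubgroup (L ≃+* L) (A : Set L)

theorem mem_autFixing {g : L ≃+* L} : g ∈ A.autFixing ↔ ∀ x ∈ A, g x = x :=
  mem_fixingSubgroup_iff _

theorem autFixing_anti (h : A ≤ B) : B.autFixing ≤ A.autFixing := fun _ hg ↦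
  mem_autFixing.2 fun x hx ↦ mem_autFixing.1 hg x (h hx)

theorem conj_smul_autFixing (g : L ≃+* L) (A : Subfield L) :
    MulAut.conj g • A.autFixing = (A.map (g : L →+* L)).autFixing := by
  ext h
  rw [Subgroup.mem_pointwise_smul_iff_inv_smul_mem, mem_autFixing, mem_autFixing]
  constructor
  · rintro H _ ⟨y, hy, rfl⟩
    have := congrArg g (H y hy)
    simpa using this
  · intro H y hy
    have := congrArg g.symm (H (g y) ⟨y, hy, rfl⟩)
    simpa using this

theorem sInf_image_autFixing (S : Set (Subfield L)) :
    sInf (autFixing '' S) = (sSup S).autFixing := by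
  ext g
  rw [Subgroup.mem_sInf, Set.forall_mem_image]
  constructor
  · intro h
    have hle : sSup S ≤ RingHom.eqLocusField (g : L →+* L) (RingHom.id L) :=
      sSup_le fun A hA x hx ↦ mem_autFixing.1 (h hA) x hx
    exact mem_autFixing.2 fun x hx ↦ hle hx
  · exact fun h A hA ↦ autFixing_anti (le_sSup hA) h

theorem map_eq_of_mem_autFixing {g : L ≃+* L} (hg : g ∈ A.autFixing) :
    A.map (g : L →+* L) = A := by
  ext x
  constructor
  · rintro ⟨y, hy, rfl⟩
    exact (mem_autFixing.1 hg y hy).symm ▸ hy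
  · exact fun hx ↦ ⟨x, hx, mem_autFixing.1 hg x hx⟩

/-- An automorphism over `A` is determined modulo those over `B` by the embedding of the compositum
`AB` over `A` it induces, and there are at most `[AB : A]` such embeddings. -/
theorem relIndex_autFixing (h : supDegree A B < ℵ₀) :
    B.autFixing.relIndex A.autFixing ≠ 0 ∧
      (B.autFixing.relIndex A.autFixing : Cardinal) ≤ supDegree A B := by
  let M : IntermediateField A L := extendScalars (le_sup_right : A ≤ B ⊔ A)
  rw [supDegree, relrank_eq_rank_of_le le_sup_right] at *
  have : FiniteDimensional A M := Module.rank_lt_aleph0_iff.1 h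
  let φ : A.autFixing → (M →ₐ[A] L) := fun g ↦
    { toRingHom := ((g : L ≃+* L) : L →+* L).comp M.val.toRingHom
      commutes' := fun a ↦ mem_autFixing.1 g.2 a a.2 }
  let ψ : A.autFixing ⧸ B.autFixing.subgroupOf A.autFixing → (M →ₐ[A] L) := fun q ↦ φ q.out
  have hψ : Function.Injective ψ := by
    intro q q' hq
    rw [← q.out_eq', ← q'.out_eq']
    refine QuotientGroup.eq.2 (Subgroup.mem_subgroupOf.2 (mem_autFixing.2 fun x hx ↦ ?_))
    have := DFunLike.congr_fun hq (⟨x, (le_sup_left : B ≤ B ⊔ A) hx⟩ : M)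
    change (q.out : L ≃+* L) x = (q'.out : L ≃+* L) x at this
    change (q.out : L ≃+* L).symm ((q'.out : L ≃+* L) x) = x
    rw [← this, RingEquiv.symm_apply_apply]
  have : Finite (A.autFixing ⧸ B.autFixing.subgroupOf A.autFixing) := Finite.of_injective ψ hψ
  refine ⟨Subgroup.FiniteIndex.index_ne_zero (H := B.autFixing.subgroupOf A.autFixing)
    (self := Subgroup.finiteIndex_of_finite_quotient), ?_⟩
  change _ ≤ Module.rank A M
  rw [← Module.finrank_eq_rank, Nat.cast_le]
  exact (Nat.card_le_card_of_injective ψ hψ).trans (card_algHom_le_finrank A M L)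

/-- Artin's theorem: a field on which `N` acts through a finite quotient is finite and separable
over the subfield of invariants. -/
theorem finite_separable_fixedPoints {N : Subgroup (L ≃+* L)} {E : Subfield L}
    (hE : ∀ g ∈ N, E.map (g : L →+* L) = E) (hfin : E.autFixing.relIndex N ≠ 0) :
    AreCommensurable (E ⊓ FixedPoints.subfield N L) E ∧
      SeparableOver (E ⊓ FixedPoints.subfield N L) E := by
  let φ : N →* (E ≃+* E) :=
    { toFun := fun g ↦
        { toFun := fun x ↦ ⟨(g : L ≃+* L) x, (hE g g.2).le ⟨x, x.2, rfl⟩⟩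
          invFun := fun x ↦ ⟨(g⁻¹ : L ≃+* L) x, (hE _ (inv_mem g.2)).le ⟨x, x.2, rfl⟩⟩
          left_inv := fun x ↦ Subtype.ext ((g : L ≃+* L).symm_apply_apply x)
          right_inv := fun x ↦ Subtype.ext ((g : L ≃+* L).apply_symm_apply x)
          map_mul' := fun x y ↦ Subtype.ext (map_mul (g : L ≃+* L) (x : L) y)
          map_add' := fun x y ↦ Subtype.ext (map_add (g : L ≃+* L) (x : L) y) }
      map_one' := rfl
      map_mul' := fun _ _ ↦ rfl }
  have hker : φ.ker = E.autFixing.subgroupOf N := by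
    ext g
    rw [MonoidHom.mem_ker, Subgroup.mem_subgroupOf, mem_autFixing]
    exact ⟨fun h x hx ↦ congrArg Subtype.val (DFunLike.congr_fun h (⟨x, hx⟩ : E)),
      fun h ↦ RingEquiv.ext fun x ↦ Subtype.ext (h x x.2)⟩
  have : Finite φ.range := by
    have : φ.ker.FiniteIndex := ⟨hker ▸ hfin⟩
    exact Finite.of_equiv _ (QuotientGroup.quotientKerEquivRange φ).toEquiv
  let X : Subfield E := FixedPoints.subfield φ.range E
  have hX : X.map E.subtype = E ⊓ FixedPoints.subfield N L := by
    ext x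
    constructor
    · rintro ⟨y, hy, rfl⟩
      exact ⟨y.2, fun g ↦ congrArg Subtype.val (hy ⟨φ g, g, rfl⟩)⟩
    · rintro ⟨hx, hxN⟩
      refine ⟨⟨x, hx⟩, ?_, rfl⟩
      rintro ⟨_, g, rfl⟩
      exact Subtype.ext (hxN g)
  have hE' : (⊤ : Subfield E).map E.subtype = E := by
    ext x
    exact ⟨fun ⟨y, _, hy⟩ ↦ hy ▸ y.2, fun hx ↦ ⟨⟨x, hx⟩, trivial, rfl⟩⟩
  have hXE : AreCommensurable X ⊤ := by
    constructor
    · change supDegree ⊤ X < ℵ₀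
      rw [supDegree_eq_one_of_le le_top]
      exact Cardinal.one_lt_aleph0
    · change supDegree X ⊤ < ℵ₀
      rw [supDegree_eq_relrank le_top, relrank_top_right]
      exact Module.rank_lt_aleph0 X E
  have hsep : SeparableOver X ⊤ := fun x _ ↦ Algebra.IsSeparable.isSeparable X x
  have h₁ := (areCommensurable_map_map E.subtype).2 hXE
  have h₂ := hsep.map E.subtype
  rw [hX, hE'] at h₁ h₂
  exact ⟨h₁, h₂⟩

end Automorphisms

/-! ### Elements of composita of finite degree -/

section Elements

variable {L : Type u} [Field L] {A B C : Subfield L}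

theorem isIntegral_natDegree_minpoly_le (h : supDegree A B < ℵ₀) {x : L} (hx : x ∈ B) :
    IsIntegral A x ∧ ((minpoly A x).natDegree : Cardinal) ≤ supDegree A B := by
  let M : IntermediateField A L := extendScalars (le_sup_right : A ≤ B ⊔ A)
  rw [supDegree, relrank_eq_rank_of_le le_sup_right] at *
  have : FiniteDimensional A M := Module.rank_lt_aleph0_iff.1 h
  let y : M := ⟨x, (le_sup_left : B ≤ B ⊔ A) hx⟩
  have hy : minpoly A y = minpoly A x := IntermediateField.minpoly_eq y
  refine ⟨IntermediateField.isIntegral_iff.1 (IsIntegral.of_finite A y), ?_⟩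
  change _ ≤ Module.rank A M
  rw [← Module.finrank_eq_rank, Nat.cast_le, ← hy]
  exact minpoly.natDegree_le y

theorem mem_range_algebraMap {x : L} : x ∈ (algebraMap A L).range ↔ x ∈ A :=
  ⟨fun ⟨y, hy⟩ ↦ hy ▸ y.2, fun hx ↦ ⟨⟨x, hx⟩, rfl⟩⟩

instance expChar_coe (p : ℕ) [ExpChar L p] (A : Subfield L) : ExpChar A p :=
  (algebraMap A L).expChar (algebraMap A L).injective p

theorem mem_of_isSeparable_of_pow_mem (p : ℕ) [ExpChar L p] {x : L} (hs : IsSeparable A x) {k : ℕ}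
    (hx : x ^ p ^ k ∈ A) : x ∈ A := by
  have : x ∈ separableClosure A L ⊓ perfectClosure A L :=
    ⟨mem_separableClosure_iff.2 hs,
      (mem_perfectClosure_iff_pow_mem p).2 ⟨k, mem_range_algebraMap.2 hx⟩⟩
  rw [separableClosure_inf_perfectClosure] at this
  obtain ⟨y, rfl⟩ := IntermediateField.mem_bot.1 this
  exact y.2

theorem pow_mem_of_supDegree_le (p : ℕ) [ExpChar L p] {d : ℕ} (hd : supDegree A B ≤ d) {x : L}
    (hxB : x ∈ B) (hx : ∃ k : ℕ, x ^ p ^ k ∈ A) : x ^ p ^ d ∈ A := by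
  have h := (isIntegral_natDegree_minpoly_le
    (hd.trans_lt Cardinal.natCast_lt_aleph0) hxB).2.trans hd
  obtain ⟨k, hk⟩ := hx
  exact mem_range_algebraMap.1 (pow_mem_range_of_natDegree_minpoly_le p (Nat.cast_le.1 h)
    ⟨k, mem_range_algebraMap.2 hk⟩)

end Elements

/-! ### Finiteness of the Eršov invariant -/

section Frobenius

variable {L : Type u} [Field L] (p : ℕ) [ExpChar L p] {A B : Subfield L}

theorem map_frobenius_le (A : Subfield L) : A.map (frobenius L p) ≤ A := by
  rintro _ ⟨x, hx, rfl⟩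
  exact pow_mem hx p

/-- Finiteness of the Eršov invariant passes up and down finite extensions `E ≤ C`, since
`[C : E ^ p]` can be computed through `E` and through `C ^ p`, where `[C ^ p : E ^ p] = [C : E]`. -/
theorem ersovInvariant_lt_aleph0_of_areCommensurable (h : AreCommensurable A B)
    (hA : ersovInvariant p A < ℵ₀) : ersovInvariant p B < ℵ₀ := by
  have hAC : relrank A (B ⊔ A) < ℵ₀ := h.2
  have hBC : relrank B (B ⊔ A) < ℵ₀ := by
    rw [sup_comm]
    exact h.1
  have hC : relrank ((B ⊔ A).map (frobenius L p)) (B ⊔ A) < ℵ₀ := by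
    refine (relrank_le_relrank_left ((gc_map_comap _).monotone_l le_sup_right)
      (map_frobenius_le p _)).trans_lt ?_
    rw [← relrank_mul_relrank (map_frobenius_le p A) le_sup_right]
    exact Cardinal.mul_lt_aleph0 hA hAC
  refine (relrank_le_relrank_right (map_frobenius_le p B)
    (le_sup_left : B ≤ B ⊔ A)).trans_lt ?_
  rw [← relrank_mul_relrank ((gc_map_comap _).monotone_l le_sup_left) (map_frobenius_le p (B ⊔ A)),
    relrank_map_map]
  exact Cardinal.mul_lt_aleph0 hBC hC

theorem map_iterateFrobenius_le (A : Subfield L) (k : ℕ) : A.map (iterateFrobenius L p k) ≤ A := by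
  rintro _ ⟨x, hx, rfl⟩
  exact pow_mem hx _

theorem relrank_map_iterateFrobenius_lt_aleph0 (hA : ersovInvariant p A < ℵ₀) (k : ℕ) :
    relrank (A.map (iterateFrobenius L p k)) A < ℵ₀ := by
  induction k with
  | zero =>
    rw [iterateFrobenius_zero]
    have : A.map (RingHom.id L) = A := SetLike.coe_injective (Set.image_id (A : Set L))
    rw [this, relrank_self]
    exact Cardinal.one_lt_aleph0
  | succ k ih =>
    have hk : A.map (iterateFrobenius L p (k + 1)) =
        (A.map (iterateFrobenius L p k)).map (frobenius L p) := by
      rw [map_map]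
      congr 1
      ext x
      simp [iterateFrobenius_def, frobenius_def, pow_succ, pow_mul]
    rw [hk, ← relrank_mul_relrank ((gc_map_comap _).monotone_l (map_iterateFrobenius_le p A k))
      (map_frobenius_le p A), relrank_map_map]
    exact Cardinal.mul_lt_aleph0 ih hA

end Frobenius

/-! ### Separable commensurability -/

section Relation

variable {L : Type u} [Field L] {A B C : Subfield L} {s : Prop}

/-- `A` and `B` are commensurable and, if the proposition `s` holds, their compositum is separable
over both. The parameter `s` allows the separable and the general case to be treated at once. -/
def SepCommensurable (s : Prop) (A B : Subfield L) : Prop :=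
  AreCommensurable A B ∧ (s → SeparableOver A B ∧ SeparableOver B A)

theorem SepCommensurable.refl (A : Subfield L) : SepCommensurable s A A :=
  ⟨.refl A, fun _ ↦ ⟨separableOver_of_le le_rfl, separableOver_of_le le_rfl⟩⟩

theorem SepCommensurable.symm (h : SepCommensurable s A B) : SepCommensurable s B A :=
  ⟨h.1.symm, fun hs ↦ (h.2 hs).symm⟩

theorem SepCommensurable.trans (h : SepCommensurable s A B) (h' : SepCommensurable s B C) :
    SepCommensurable s A C :=
  ⟨h.1.trans h'.1, fun hs ↦ ⟨(h.2 hs).1.trans (h'.2 hs).1, (h'.2 hs).2.trans (h.2 hs).2⟩⟩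

theorem SepCommensurable.sup (h : SepCommensurable s A C) (h' : SepCommensurable s B C) :
    SepCommensurable s (A ⊔ B) C :=
  ⟨h.1.sup h'.1, fun hs ↦ ⟨(h.2 hs).1.mono_left le_sup_left, (h.2 hs).2.sup (h'.2 hs).2⟩⟩

theorem SepCommensurable.map {L' : Type u} [Field L'] (f : L →+* L')
    (h : SepCommensurable s A B) : SepCommensurable s (A.map f) (B.map f) :=
  ⟨(areCommensurable_map_map f).2 h.1, fun hs ↦ ⟨(h.2 hs).1.map f, (h.2 hs).2.map f⟩⟩

theorem SepCommensurable.sSup {S : Set (Subfield L)} (hfin : S.Finite) (hne : S.Nonempty)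
    (h : ∀ A ∈ S, SepCommensurable s A C) : SepCommensurable s (sSup S) C := by
  induction S, hfin using Set.Finite.induction_on with
  | empty => exact absurd hne Set.not_nonempty_empty
  | @insert A S _ _ ih =>
    rw [sSup_insert]
    obtain rfl | hS := S.eq_empty_or_nonempty
    · rw [sSup_empty, sup_bot_eq]
      exact h A (Set.mem_insert A _)
    · exact (h A (Set.mem_insert A S)).sup (ih hS fun B hB ↦ h B (Set.mem_insert_of_mem A hB))

end Relation

/-! ### A subfield invariant up to pure inseparability -/

section AlgClosed

open scoped Pointwise

variable {Ω : Type u} [Field Ω] (p : ℕ) [ExpChar Ω p]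

theorem mem_fixedPoints_subgroup {N : Subgroup (Ω ≃+* Ω)} {x : Ω} :
    x ∈ FixedPoints.subfield N Ω ↔ ∀ g ∈ N, g x = x :=
  ⟨fun h g hg ↦ h ⟨g, hg⟩, fun h g ↦ h g g.2⟩

theorem exists_pow_mem_of_forall_autFixing [IsAlgClosed Ω] {A : Subfield Ω} {x : Ω}
    (hx : IsIntegral A x) (hfix : ∀ g ∈ A.autFixing, g x = x) : ∃ k : ℕ, x ^ p ^ k ∈ A := by
  obtain ⟨k, hk⟩ := exists_pow_mem_range_of_forall_algEquiv p hx fun g ↦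
    hfix g.toRingEquiv (mem_autFixing.2 fun a ha ↦ g.commutes ⟨a, ha⟩)
  exact ⟨k, mem_range_algebraMap.1 hk⟩

/-- If `N` meets the fixing group of `E` in a subgroup of finite index, then `E` has only finitely
many translates under `N`, and their compositum is an `N`-invariant field. -/
theorem exists_sup_translates {s : Prop} {N : Subgroup (Ω ≃+* Ω)} {E : Subfield Ω}
    (hN : E.autFixing.relIndex N ≠ 0)
    (hE : ∀ g ∈ N, SepCommensurable s (E.map (g : Ω →+* Ω)) E) :
    ∃ E' : Subfield Ω, E ≤ E' ∧ SepCommensurable s E' E ∧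
      ∀ g ∈ N, E'.map (g : Ω →+* Ω) = E' := by
  let S : Set (Subfield Ω) := {A | ∃ g ∈ N, E.map (g : Ω →+* Ω) = A}
  have hfin : S.Finite := by
    have : (E.autFixing.subgroupOf N).FiniteIndex := ⟨hN⟩
    -- The translate `E.map g` depends only on the coset of `g` modulo the fixing group of `E`.
    let f : N ⧸ E.autFixing.subgroupOf N → Subfield Ω :=
      fun q ↦ E.map (((q.out : N) : Ω ≃+* Ω) : Ω →+* Ω)
    refine (Set.finite_range f).subset ?_
    rintro _ ⟨g, hg, rfl⟩
    refine ⟨QuotientGroup.mk ⟨g, hg⟩, ?_⟩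
    let q : N ⧸ E.autFixing.subgroupOf N := QuotientGroup.mk ⟨g, hg⟩
    have hq : g⁻¹ * ((q.out : N) : Ω ≃+* Ω) ∈ E.autFixing := by
      have := QuotientGroup.eq.1 (q.out_eq').symm
      simpa [Subgroup.mem_subgroupOf] using this
    have := map_eq_of_mem_autFixing hq
    rw [map_mul_ringEquiv] at this
    have := congrArg (fun A ↦ A.map (g : Ω →+* Ω)) this
    simpa only [map_map_inv] using this
  have hES : E ∈ S := ⟨1, one_mem N, map_one_ringEquiv E⟩
  have hle : ∀ g ∈ N, (sSup S).map (g : Ω →+* Ω) ≤ sSup S := by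
    intro g hg
    rw [map_le_iff_le_comap]
    refine sSup_le ?_
    rintro _ ⟨h, hh, rfl⟩
    rw [← map_le_iff_le_comap, ← map_mul_ringEquiv]
    exact le_sSup ⟨g * h, mul_mem hg hh, rfl⟩
  refine ⟨sSup S, le_sSup hES, .sSup hfin ⟨E, hES⟩ ?_, fun g hg ↦ (hle g hg).antisymm ?_⟩
  · rintro _ ⟨g, hg, rfl⟩
    exact hE g hg
  · have := (gc_map_comap (g : Ω →+* Ω)).monotone_l (hle g⁻¹ (inv_mem hg))
    rwa [map_map_inv] at this

/-- The core of the argument: inside an algebraically closed field, there is a field `M`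
commensurable with the family (separably so if the family is) such that all translates of `M` under
`Γ` are purely inseparable over `M`, and `M` is purely inseparable over the compositum of the
family. Here `M` is the field of `N`-invariants of an `N`-invariant compositum `E'` of translates of
members, where `N` is the group attached by Schlichting's theorem to the fixing groups of the
members. -/
theorem exists_purelyInseparably_invariant [IsAlgClosed Ω] {s : Prop} {𝔉 : Set (Subfield Ω)}
    (hne : 𝔉.Nonempty) {n : ℕ} (hn : ∀ F ∈ 𝔉, ∀ E ∈ 𝔉, supDegree E F ≤ n)
    (hs : s → ∀ F ∈ 𝔉, ∀ E ∈ 𝔉, SeparableOver E F) {Γ : Subgroup (Ω ≃+* Ω)}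
    (hΓ : ∀ g ∈ Γ, ∀ F ∈ 𝔉, F.map (g : Ω →+* Ω) ∈ 𝔉) :
    ∃ M : Subfield Ω, (∀ F ∈ 𝔉, SepCommensurable s M F) ∧
      (∀ g ∈ Γ, ∀ x ∈ M.map (g : Ω →+* Ω), ∃ k : ℕ, x ^ p ^ k ∈ M) ∧
      ∀ x ∈ M, ∃ k : ℕ, x ^ p ^ k ∈ sSup 𝔉 := by
  have h𝔉 : ∀ F ∈ 𝔉, ∀ E ∈ 𝔉, SepCommensurable s F E := fun F hF E hE ↦
    ⟨⟨(hn F hF E hE).trans_lt Cardinal.natCast_lt_aleph0,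
      (hn E hE F hF).trans_lt Cardinal.natCast_lt_aleph0⟩,
      fun h ↦ ⟨hs h E hE F hF, hs h F hF E hE⟩⟩
  obtain ⟨N, hNΓ, hNle, hNfin, hS⟩ :=
    Subgroup.exists_conj_invariant_of_uniformly_commensurable (𝔉 := autFixing '' 𝔉)
    (hne.image _) (n := n) (Γ := Γ)
    (by
      rintro _ ⟨F, hF, rfl⟩ _ ⟨E, hE, rfl⟩
      exact (relIndex_autFixing ((hn E hE F hF).trans_lt Cardinal.natCast_lt_aleph0)).1)
    (by
      rintro _ ⟨F, hF, rfl⟩ _ ⟨E, hE, rfl⟩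
      exact Nat.cast_le.1 ((relIndex_autFixing
        ((hn E hE F hF).trans_lt Cardinal.natCast_lt_aleph0)).2.trans (hn E hE F hF)))
    (by
      rintro g hg _ ⟨F, hF, rfl⟩
      exact ⟨_, hΓ g hg F hF, (conj_smul_autFixing g F).symm⟩)
  obtain ⟨F₀, hF₀⟩ := hne
  obtain ⟨S, hS𝔉, hSfin, hSne, hSN⟩ : ∃ S ⊆ 𝔉, S.Finite ∧ S.Nonempty ∧
      sInf (autFixing '' S) ≤ N := by
    obtain ⟨T, h₁, h₂, h₃, h₄⟩ := hS
    obtain ⟨S, h₅, h₆, h₇⟩ := (Set.exists_subset_image_finite_and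
      (p := fun T ↦ T.Nonempty ∧ sInf T ≤ N)).1 ⟨T, h₃, h₁, h₂, h₄⟩
    exact ⟨S, h₅, h₆, h₇.1.of_image, h₇.2⟩
  rw [sInf_image_autFixing] at hSN
  let E := sSup S
  have hEF : ∀ F ∈ 𝔉, SepCommensurable s E F := fun F hF ↦
    .sSup hSfin hSne fun A hA ↦ h𝔉 A (hS𝔉 hA) F hF
  have hEN : E.autFixing.relIndex N ≠ 0 :=
    Subgroup.relIndex_ne_zero_trans (relIndex_autFixing (hEF F₀ hF₀).1.1).1
      (hNfin _ ⟨F₀, hF₀, rfl⟩)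
  -- The group `N` preserves the commensurability class, since each fixing group of a member does.
  have hNmap : ∀ g ∈ N, SepCommensurable s (E.map (g : Ω →+* Ω)) E := by
    let T : Subgroup (Ω ≃+* Ω) :=
      { carrier := {g | SepCommensurable s (E.map (g : Ω →+* Ω)) E}
        one_mem' := by
          change SepCommensurable s _ _
          rw [map_one_ringEquiv]
          exact .refl E
        mul_mem' := fun {a b} ha hb ↦ by
          change SepCommensurable s _ _
          rw [map_mul_ringEquiv]
          exact (hb.map _).trans ha
        inv_mem' := fun {a} ha ↦ by
          have := (SepCommensurable.map ((a⁻¹ : Ω ≃+* Ω) : Ω →+* Ω) ha).symm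
          rwa [map_inv_map] at this }
    have hT : sSup (autFixing '' 𝔉) ≤ T := by
      refine sSup_le ?_
      rintro _ ⟨F, hF, rfl⟩ g hg
      have := (hEF F hF).map (g : Ω →+* Ω)
      rw [map_eq_of_mem_autFixing hg] at this
      exact this.trans (hEF F hF).symm
    exact fun g hg ↦ hT (hNle hg)
  obtain ⟨E', hEE', hE'E, hE'N⟩ := exists_sup_translates hEN hNmap
  have hE'fin : E'.autFixing.relIndex N ≠ 0 :=
    Subgroup.relIndex_ne_zero_trans (relIndex_autFixing hE'E.1.1).1 hEN
  obtain ⟨hM₁, hM₂⟩ := finite_separable_fixedPoints hE'N hE'fin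
  let M := E' ⊓ FixedPoints.subfield N Ω
  have hME' : SepCommensurable s M E' := ⟨hM₁, fun _ ↦ ⟨hM₂, separableOver_of_le inf_le_left⟩⟩
  have hMF : ∀ F ∈ 𝔉, SepCommensurable s M F := fun F hF ↦ (hME'.trans hE'E).trans (hEF F hF)
  -- `N` contains the fixing group of `E`, so invariants of `N` are purely inseparable over `E`.
  have hfix : ∀ x ∈ FixedPoints.subfield N Ω, IsIntegral E x →
      ∃ k : ℕ, x ^ p ^ k ∈ E ∧ x ^ p ^ k ∈ M := fun x hx hxE ↦ by
    obtain ⟨k, hk⟩ := exists_pow_mem_of_forall_autFixing p hxE fun g hg ↦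
      mem_fixedPoints_subgroup.1 hx g (hSN hg)
    exact ⟨k, hk, hEE' hk, pow_mem hx _⟩
  refine ⟨M, hMF, fun g hg x hx ↦ ?_, fun x hx ↦ ?_⟩
  · have hxE : IsIntegral E x := by
      have h := ((hEF F₀ hF₀).trans (h𝔉 _ hF₀ _ (hΓ g hg F₀ hF₀))).trans
        ((hMF F₀ hF₀).symm.map (g : Ω →+* Ω))
      exact (isIntegral_natDegree_minpoly_le h.1.2 hx).1
    obtain ⟨y, hy, rfl⟩ := hx
    obtain ⟨k, -, hk⟩ := hfix (g y) (mem_fixedPoints_subgroup.2 fun h hh ↦ by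
      rw [← hNΓ g hg, Subgroup.mem_pointwise_smul_iff_inv_smul_mem] at hh
      have := congrArg g (mem_fixedPoints_subgroup.1 hy.2 _ hh)
      simpa using this) hxE
    exact ⟨k, hk⟩
  · have hxE : IsIntegral E x :=
      (isIntegral_natDegree_minpoly_le (hME'.trans hE'E).1.1 hx).1
    obtain ⟨k, hk, -⟩ := hfix x hx.2 hxE
    exact ⟨k, sSup_le_sSup hS𝔉 hk⟩

end AlgClosed

/-! ### Removing the inseparability -/

section Invariant

variable {Ω : Type u} [Field Ω]

theorem map_eq_of_forall_map_le {Γ : Subgroup (Ω ≃+* Ω)} {A : Subfield Ω}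
    (h : ∀ g ∈ Γ, A.map (g : Ω →+* Ω) ≤ A) {g : Ω ≃+* Ω} (hg : g ∈ Γ) :
    A.map (g : Ω →+* Ω) = A := by
  refine (h g hg).antisymm ?_
  have := (gc_map_comap (g : Ω →+* Ω)).monotone_l (h g⁻¹ (inv_mem hg))
  rwa [map_map_inv] at this

/-- In the separable case the field `M` of `exists_purelyInseparably_invariant` is itself invariant,
since its translates are both separable and purely inseparable over it. -/
theorem exists_invariant_of_separableOver [IsAlgClosed Ω] (p : ℕ) [ExpChar Ω p]
    {𝔉 : Set (Subfield Ω)}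
    (hne : 𝔉.Nonempty) {n : ℕ} (hn : ∀ F ∈ 𝔉, ∀ E ∈ 𝔉, supDegree E F ≤ n)
    (hs : ∀ F ∈ 𝔉, ∀ E ∈ 𝔉, SeparableOver E F) {Γ : Subgroup (Ω ≃+* Ω)}
    (hΓ : ∀ g ∈ Γ, ∀ F ∈ 𝔉, F.map (g : Ω →+* Ω) ∈ 𝔉) :
    ∃ N : Subfield Ω, N ≤ sSup 𝔉 ∧ (∀ g ∈ Γ, N.map (g : Ω →+* Ω) = N) ∧
      ∀ F ∈ 𝔉, AreCommensurable N F := by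
  obtain ⟨M, hM, hMΓ, hMX⟩ := exists_purelyInseparably_invariant p (s := True) hne hn
    (fun _ ↦ hs) hΓ
  obtain ⟨F, hF⟩ := hne
  refine ⟨M, fun x hx ↦ ?_, fun g ↦ map_eq_of_forall_map_le fun g hg x hx ↦ ?_,
    fun F hF ↦ (hM F hF).1⟩
  · obtain ⟨k, hk⟩ := hMX x hx
    have hsep : SeparableOver (sSup 𝔉) M := ((hM F hF).2 trivial).2.mono_left (le_sSup hF)
    exact mem_of_isSeparable_of_pow_mem p (hsep x hx) hk
  · obtain ⟨k, hk⟩ := hMΓ g hg x hx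
    have hsep : SepCommensurable True M (M.map (g : Ω →+* Ω)) :=
      (hM _ (hΓ g hg F hF)).trans ((hM F hF).symm.map (g : Ω →+* Ω))
    exact mem_of_isSeparable_of_pow_mem p ((hsep.2 trivial).1 x hx) hk

/-- When the Eršov invariants are finite, let `q` be a large power of `p`; the compositum `N` of the
fields of `q`-th powers of all translates of `M` is invariant and satisfies `M ^ q ≤ N ≤ M`, where
`[M : M ^ q]` is finite. -/
theorem exists_invariant_of_ersovInvariant [IsAlgClosed Ω] (p : ℕ) [ExpChar Ω p]
    {𝔉 : Set (Subfield Ω)}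
    (hne : 𝔉.Nonempty) {n : ℕ} (hn : ∀ F ∈ 𝔉, ∀ E ∈ 𝔉, supDegree E F ≤ n)
    (hp : ∀ F ∈ 𝔉, ersovInvariant p F < ℵ₀) {Γ : Subgroup (Ω ≃+* Ω)}
    (hΓ : ∀ g ∈ Γ, ∀ F ∈ 𝔉, F.map (g : Ω →+* Ω) ∈ 𝔉) :
    ∃ N : Subfield Ω, N ≤ sSup 𝔉 ∧ (∀ g ∈ Γ, N.map (g : Ω →+* Ω) = N) ∧
      ∀ F ∈ 𝔉, AreCommensurable N F := by
  obtain ⟨M, hM, hMΓ, hMX⟩ := exists_purelyInseparably_invariant p (s := False) hne hn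
    (fun h ↦ h.elim) hΓ
  obtain ⟨F, hF⟩ := hne
  obtain ⟨a, ha⟩ := Cardinal.lt_aleph0.1 (show supDegree M F < ℵ₀ from (hM F hF).1.2)
  obtain ⟨b, hb⟩ := Cardinal.lt_aleph0.1 (show supDegree F M < ℵ₀ from (hM F hF).1.1)
  let φ := iterateFrobenius Ω p (a * n * b + b)
  -- The translates of `M` have bounded degree over `M` and over `sSup 𝔉`, so that a fixed power of
  -- Frobenius maps them all into both fields.
  have hdegM : ∀ g ∈ Γ, supDegree M (M.map (g : Ω →+* Ω)) ≤ (a * n * b + b : ℕ) := by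
    intro g hg
    have h₁ : supDegree (F.map (g : Ω →+* Ω)) (M.map (g : Ω →+* Ω)) = b := by
      rw [supDegree_map, hb]
    have h₂ := hn _ (hΓ g hg F hF) F hF
    calc supDegree M (M.map (g : Ω →+* Ω))
        ≤ supDegree M (F.map (g : Ω →+* Ω)) * b := by
          rw [← h₁]
          exact supDegree_triangle (h₁ ▸ Cardinal.natCast_lt_aleph0)
      _ ≤ a * n * b := by
          refine mul_le_mul_left ?_ _
          rw [← ha]
          exact (supDegree_triangle (h₂.trans_lt Cardinal.natCast_lt_aleph0)).trans
            (mul_le_mul_right h₂ _)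
      _ ≤ _ := by
          rw [← Nat.cast_mul, ← Nat.cast_mul]
          exact Nat.cast_le.2 (Nat.le_add_right _ _)
  have hdegX : ∀ g ∈ Γ, supDegree (sSup 𝔉) (M.map (g : Ω →+* Ω)) ≤ (a * n * b + b : ℕ) := by
    intro g hg
    have h₁ : supDegree (F.map (g : Ω →+* Ω)) (M.map (g : Ω →+* Ω)) = b := by
      rw [supDegree_map, hb]
    refine (supDegree_anti_left (le_sSup (hΓ g hg F hF))
      (h₁ ▸ Cardinal.natCast_lt_aleph0)).trans ?_
    rw [h₁]
    exact Nat.cast_le.2 (Nat.le_add_left _ _)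
  have hφM : ∀ g ∈ Γ, (M.map (g : Ω →+* Ω)).map φ ≤ M := by
    rintro g hg _ ⟨x, hx, rfl⟩
    exact pow_mem_of_supDegree_le p (hdegM g hg) hx (hMΓ g hg x hx)
  have hφX : ∀ g ∈ Γ, (M.map (g : Ω →+* Ω)).map φ ≤ sSup 𝔉 := by
    rintro g hg _ ⟨x, hx, rfl⟩
    refine pow_mem_of_supDegree_le p (hdegX g hg) hx ?_
    obtain ⟨y, hy, rfl⟩ := hx
    obtain ⟨k, hk⟩ := hMX y hy
    have hgX : sSup 𝔉 ≤ (sSup 𝔉).comap (g : Ω →+* Ω) := sSup_le fun A hA ↦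
      map_le_iff_le_comap.1 (le_sSup (hΓ g hg A hA))
    refine ⟨k, ?_⟩
    rw [← map_pow]
    exact hgX hk
  let N : Subfield Ω := sSup {A | ∃ g ∈ Γ, (M.map (g : Ω →+* Ω)).map φ = A}
  have hNM : N ≤ M := sSup_le fun _ ⟨g, hg, h⟩ ↦ h ▸ hφM g hg
  have hφN : M.map φ ≤ N := le_sSup ⟨1, one_mem Γ, by rw [map_one_ringEquiv]⟩
  have hMN : AreCommensurable M N := by
    constructor
    · change supDegree N M < ℵ₀
      rw [supDegree_eq_relrank hNM]
      exact (relrank_le_relrank_left hφN hNM).trans_lt (relrank_map_iterateFrobenius_lt_aleph0 p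
        (ersovInvariant_lt_aleph0_of_areCommensurable p (hM F hF).1.symm (hp F hF)) _)
    · change supDegree M N < ℵ₀
      rw [supDegree_eq_one_of_le hNM]
      exact Cardinal.one_lt_aleph0
  refine ⟨N, sSup_le fun _ ⟨g, hg, h⟩ ↦ h ▸ hφX g hg, fun g ↦ map_eq_of_forall_map_le fun g hg ↦ ?_,
    fun F hF ↦ hMN.symm.trans (hM F hF).1⟩
  rw [map_le_iff_le_comap]
  refine sSup_le ?_
  rintro _ ⟨h, hh, rfl⟩
  rw [← map_le_iff_le_comap]
  refine le_sSup ⟨g * h, mul_mem hg hh, ?_⟩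
  have hcomm : φ.comp (g : Ω →+* Ω) = (g : Ω →+* Ω).comp φ :=
    RingHom.ext fun x ↦ (map_pow (g : Ω →+* Ω) x _).symm
  rw [map_mul_ringEquiv, map_map _ φ (g : Ω →+* Ω), hcomm, ← map_map]

end Invariant

/-! ### Passage to the algebraic closure -/

section Lifting

variable {K : Type u} [Field K]

/-- The group of automorphisms of the algebraic closure of `K` that extend an element of `Γ`. -/
def liftSubgroup (Γ : Subgroup (K ≃+* K)) :
    Subgroup (AlgebraicClosure K ≃+* AlgebraicClosure K) where
  carrier := {g | ∃ γ ∈ Γ, ∀ x, g (algebraMap K _ x) = algebraMap K _ (γ x)}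
  one_mem' := ⟨1, one_mem Γ, fun _ ↦ rfl⟩
  mul_mem' := by
    rintro a b ⟨α, hα, ha⟩ ⟨β, hβ, hb⟩
    exact ⟨α * β, mul_mem hα hβ, fun x ↦ by simp [ha, hb]⟩
  inv_mem' := by
    rintro a ⟨α, hα, ha⟩
    refine ⟨α⁻¹, inv_mem hα, fun x ↦ a.injective ?_⟩
    rw [ha]
    simp

theorem exists_lift (γ : K ≃+* K) : ∃ g : AlgebraicClosure K ≃+* AlgebraicClosure K,
    ∀ x, g (algebraMap K _ x) = algebraMap K _ (γ x) :=
  ⟨IsAlgClosure.equivOfEquiv _ _ γ, IsAlgClosure.equivOfEquiv_algebraMap _ _ γ⟩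

theorem map_algebraMap_map {g : AlgebraicClosure K ≃+* AlgebraicClosure K} {γ : K ≃+* K}
    (h : ∀ x, g (algebraMap K _ x) = algebraMap K _ (γ x)) (A : Subfield K) :
    (A.map (algebraMap K (AlgebraicClosure K))).map (g : AlgebraicClosure K →+* AlgebraicClosure K)
      = (A.map (γ : K →+* K)).map (algebraMap K (AlgebraicClosure K)) := by
  rw [map_map, map_map]
  congr 1
  exact RingHom.ext h

end Lifting

end Subfield

theorem mainTheorem3 {K : Type*} [Field K] (p : ℕ) [ExpChar K p]
    (Γ : Subgroup (K ≃+* K)) (𝔉 : Set (Subfield K))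
    (hinv : Subfield.IsInvariantFamily Γ 𝔉)
    (hunif : Subfield.UniformlyCommensurable 𝔉)
    (h : (∀ F ∈ 𝔉, ∀ F' ∈ 𝔉, Subfield.IsSeparableCompositum F F') ∨
      (∀ F ∈ 𝔉, Subfield.ersovInvariant p F < ℵ₀)) :
    ∃ N : Subfield K, Subfield.IsInvariantUnder Γ N ∧
      ∀ F ∈ 𝔉, Subfield.AreCommensurable N F := by
  obtain rfl | hne := 𝔉.eq_empty_or_nonempty
  · exact ⟨⊥, fun γ _ ↦ Subfield.map_bot _, by simp⟩
  obtain ⟨n, hn⟩ := hunif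
  let ι := algebraMap K (AlgebraicClosure K)
  have : ExpChar (AlgebraicClosure K) p := expChar_of_injective_algebraMap ι.injective p
  let 𝔉' : Set (Subfield (AlgebraicClosure K)) := (Subfield.map ι) '' 𝔉
  have hn' : ∀ F ∈ 𝔉', ∀ E ∈ 𝔉', Subfield.supDegree E F ≤ n := by
    rintro _ ⟨F, hF, rfl⟩ _ ⟨E, hE, rfl⟩
    rw [Subfield.supDegree_map]
    exact hn F hF E hE
  have hΓ' : ∀ g ∈ Subfield.liftSubgroup Γ, ∀ F ∈ 𝔉',
      F.map (g : AlgebraicClosure K →+* AlgebraicClosure K) ∈ 𝔉' := by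
    rintro g ⟨γ, hγ, hgγ⟩ _ ⟨F, hF, rfl⟩
    exact ⟨_, hinv γ hγ F hF, (Subfield.map_algebraMap_map hgγ F).symm⟩
  obtain ⟨N, hNX, hNΓ, hN⟩ : ∃ N : Subfield (AlgebraicClosure K), N ≤ sSup 𝔉' ∧
      (∀ g ∈ Subfield.liftSubgroup Γ,
        N.map (g : AlgebraicClosure K →+* AlgebraicClosure K) = N) ∧
      ∀ F ∈ 𝔉', Subfield.AreCommensurable N F := by
    obtain h | h := h
    · refine Subfield.exists_invariant_of_separableOver p (hne.image _) hn' ?_ hΓ'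
      rintro _ ⟨F, hF, rfl⟩ _ ⟨E, hE, rfl⟩
      exact (h E hE F hF).separableOver.map ι
    · refine Subfield.exists_invariant_of_ersovInvariant p (hne.image _) hn' ?_ hΓ'
      rintro _ ⟨F, hF, rfl⟩
      have hcomm : (F.map ι).map (frobenius (AlgebraicClosure K) p) =
          (F.map (frobenius K p)).map ι := by
        rw [Subfield.map_map, Subfield.map_map]
        congr 1
        exact RingHom.ext fun x ↦ (map_pow ι x p).symm
      rw [Subfield.ersovInvariant, hcomm, Subfield.relrank_map_map]
      exact h F hF
  have hNι : (N.comap ι).map ι = N := by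
    rw [Subfield.map_comap_eq_self]
    refine hNX.trans (sSup_le ?_)
    rintro _ ⟨F, -, rfl⟩ _ ⟨x, -, rfl⟩
    exact ⟨x, rfl⟩
  refine ⟨N.comap ι, fun γ hγ ↦ ?_, fun F hF ↦ ?_⟩
  · obtain ⟨g, hg⟩ := Subfield.exists_lift γ
    have hmap := Subfield.map_algebraMap_map hg (N.comap ι)
    change ((N.comap ι).map ι).map _ = ((N.comap ι).map _).map ι at hmap
    rw [hNι, hNΓ g ⟨γ, hγ, hg⟩] at hmap
    rw [← Subfield.comap_map ι ((N.comap ι).map (γ : K →+* K)), ← hmap]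
  · rw [← Subfield.areCommensurable_map_map ι, hNι]
    exact hN _ ⟨F, hF, rfl⟩
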